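/- Let $k$ be a field, let $Y$ be a smooth projective $k$-scheme of pure dimension $n$ (for example, a smooth projective variety of dimension $n$ over $k$), and let $U$ be a $k$-scheme of finite type. Let $Z\subset U\times_kY$ be a closed subscheme that is equidimensional of dimension $d$ over $U$, meaning that every irreducible component of every fibre of the projection $Z\to U$ has dimension $d$ (fibres may be empty), and suppose that $d\le n-2$. Let $j\colon (U\times_kY)\setminus Z\to U\times_kY$ be the inclusion of the open complement. Then the restriction map $$j^*\colon \mathrm{Pic}(U\times_kY)\to \mathrm{Pic}((U\times_kY)\setminus Z),\qquad [\mathcal L]\mapsto[j^*\mathcal L],$$ is injective; that is, if $\mathcal L_1,\mathcal L_2$ are invertible sheaves on $U\times_kY$ with $j^*\mathcal L_1\cong j^*\mathcal L_2$, then $\mathcal L_1\cong\mathcal L_2$. -/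

import Mathlib

open CategoryTheory CategoryTheory.Limits AlgebraicGeometry

universe u

namespace PicardRestriction

noncomputable section

/-- A topological space is of pure dimension `n` if each of its irreducible components has Krull
dimension `n`. (The empty space has pure dimension `n` for every `n`.) -/
def IsPureDim (T : Type*) [TopologicalSpace T] (n : ℕ) : Prop :=
  ∀ W ∈ irreducibleComponents T, topologicalKrullDim W = n

/-- `f : Z ⟶ U` is equidimensional of dimension `d` if every fibre `f⁻¹(u)` is
of pure dimension `d` (empty fibres are allowed). Conventions which moreover require irreducible
components of `Z` to dominate irreducible components of `U` are more restrictive. -/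
def IsEquidimensional {Z U : Scheme.{u}} (f : Z ⟶ U) (d : ℕ) : Prop :=
  ∀ x : U, IsPureDim (f.fiber x) d

section Projective

attribute [local instance] MvPolynomial.gradedAlgebra

/-- The projective space `ℙⁿ` over a ring `k`, as `Proj k[x₀, …, xₙ]`. -/
def projSpace (k : Type u) [CommRing k] (n : ℕ) : Scheme.{u} :=
  Proj (MvPolynomial.homogeneousSubmodule (Fin (n + 1)) k)

/-- The structure morphism `ℙⁿ ⟶ Spec k`. -/
def projSpaceToSpec (k : Type u) [CommRing k] (n : ℕ) :
    projSpace k n ⟶ Spec (CommRingCat.of k) :=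
  Proj.toSpecZero (MvPolynomial.homogeneousSubmodule (Fin (n + 1)) k) ≫
    Spec.map (CommRingCat.ofHom
      (algebraMap k (MvPolynomial.homogeneousSubmodule (Fin (n + 1)) k 0)))

end Projective

/-- A `k`-scheme is projective if it admits a closed immersion over `k` into some `ℙⁿ`. -/
def IsProjectiveOver {k : Type u} [CommRing k] {Y : Scheme.{u}}
    (f : Y ⟶ Spec (CommRingCat.of k)) : Prop :=
  ∃ (n : ℕ) (i : Y ⟶ projSpace k n), IsClosedImmersion i ∧ i ≫ projSpaceToSpec k n = f

/-- The structure sheaf `𝒪_X` as a module over itself. -/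
abbrev structureModule (X : Scheme.{u}) : X.Modules :=
  SheafOfModules.unit X.ringCatSheaf

/-- An `𝒪_X`-module is an invertible sheaf if it is locally isomorphic to `𝒪_X`. -/
def IsInvertibleSheaf {X : Scheme.{u}} (L : X.Modules) : Prop :=
  ∀ x : X, ∃ V : X.Opens, x ∈ V ∧
    Nonempty ((Scheme.Modules.pullback V.ι).obj L ≅ structureModule V)

theorem opensMap_final {X Y : TopCat.{u}} (f : X ⟶ Y) :
    (TopologicalSpace.Opens.map f).Final where
  out V := by
    let t : StructuredArrow V (TopologicalSpace.Opens.map f) :=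
      StructuredArrow.mk (Y := ⊤) (homOfLE (show V ≤ ⊤ from le_top))
    have ht : IsTerminal t := IsTerminal.ofUniqueHom
      (fun s => StructuredArrow.homMk (homOfLE (le_top : s.right ≤ ⊤)) (Subsingleton.elim _ _))
      (fun _ _ => StructuredArrow.hom_ext _ _ (Subsingleton.elim _ _))
    exact isConnected_of_isTerminal _ ht

/-- The pullback of the structure sheaf is the structure sheaf. -/
theorem nonempty_pullback_structureModule_iso {X Y : Scheme.{u}} (f : X ⟶ Y) :
    Nonempty ((Scheme.Modules.pullback f).obj (structureModule Y) ≅ structureModule X) := by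
  have h : (SheafOfModules.pushforward.{u} f.toRingCatSheafHom).IsRightAdjoint :=
    inferInstanceAs (Scheme.Modules.pushforward f).IsRightAdjoint
  have h' := opensMap_final f.base
  have := SheafOfModules.instIsIsoPullbackObjUnitToUnitOfFinal f.toRingCatSheafHom
  exact ⟨@asIso _ _ _ _ (SheafOfModules.pullbackObjUnitToUnit f.toRingCatSheafHom) this⟩

open Scheme.Modules in
/-- The pullback of an invertible sheaf is an invertible sheaf. -/
theorem IsInvertibleSheaf.pullback {X Y : Scheme.{u}} (f : X ⟶ Y) {L : Y.Modules}
    (hL : IsInvertibleSheaf L) : IsInvertibleSheaf ((Scheme.Modules.pullback f).obj L) := by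
  intro x
  obtain ⟨V, hxV, ⟨e⟩⟩ := hL (f x)
  obtain ⟨e'⟩ := nonempty_pullback_structureModule_iso (f ∣_ V)
  exact ⟨f ⁻¹ᵁ V, hxV, ⟨(pullbackComp (f ⁻¹ᵁ V).ι f).app L ≪≫
    (pullbackCongr (morphismRestrict_ι f V).symm).app L ≪≫
    ((pullbackComp (f ∣_ V) V.ι).symm).app L ≪≫
    (Scheme.Modules.pullback (f ∣_ V)).mapIso e ≪≫ e'⟩⟩

/-- The category of invertible sheaves on `X`, as a full subcategory of all `𝒪_X`-modules. -/
abbrev InvertibleSheaf (X : Scheme.{u}) : Type (u + 1) :=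
  ObjectProperty.FullSubcategory (fun L : X.Modules => IsInvertibleSheaf L)

/-- `Pic X`: the isomorphism classes of invertible sheaves on `X`. Its group law is not recorded, as
injectivity of the (homomorphic) pullback map only concerns the underlying sets. -/
def Pic (X : Scheme.{u}) : Type (u + 1) :=
  Quotient (isIsomorphicSetoid (InvertibleSheaf X))

/-- The pullback map `f^* : Pic Y → Pic X`, `[L] ↦ [f^* L]`. -/
def Pic.map {X Y : Scheme.{u}} (f : X ⟶ Y) : Pic Y → Pic X :=
  Quotient.map (fun L => ⟨(Scheme.Modules.pullback f).obj L.obj, L.property.pullback f⟩)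
    (fun _ _ ⟨e⟩ => ⟨ObjectProperty.isoMk _ ((Scheme.Modules.pullback f).mapIso
      ((ObjectProperty.ι _).mapIso e))⟩)

/-- The open complement of a closed subscheme `i : Z ⟶ X`. -/
def complement {Z X : Scheme.{u}} (i : Z ⟶ X) [IsClosedImmersion i] : X.Opens :=
  ⟨(Set.range i)ᶜ, i.isClosedEmbedding.isClosed_range.isOpen_compl⟩

end

end PicardRestriction

/-! Write X = U × Y and j for the inclusion of the complement of Z. If L → j_* j^* L is an
isomorphism for every invertible L, then L is recovered from j^* L. This is a local question, so L
may be replaced by the structure sheaf (`picMap_ι_injective`): functions on small affine opens must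
extend uniquely across Z, that is, X must have depth at least 2 along Z.

Étale coordinates on Y base change to affine charts Spec R of X over a Noetherian Spec A, with R
flat over A[x₁, …, x_m] (`exists_flatChart`). Here m ≥ n, by comparing transcendence degrees at a
generic point (`le_of_etaleChart`).

Since U may be singular, depth comes from the fibres over A. A fibre ring C is flat over κ(p)[x₁, …,
x_m], and Z meets the fibre in dimension at most d ≤ m - 2. Hence the ideal of Z, contracted to the
polynomial ring, contains two coprime polynomials (`exists_isRelPrime_of_ringKrullDim_le`), and
flatness makes them behave as a regular sequence on C. A dévissage over finite A-modules M passes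
from κ(p) to A/p and on to R ⊗ M, in particular to R (`homsExtend_of_fibre_dimension_le`).

Local cohomology is avoided: `NoSectionsSupported` and `HomsExtend` together play the role of depth
at least 2, and `restrictSections_bijective_of_homsExtend` turns them into extension of functions.
-/

namespace PicardRestriction

/-! ### Dévissage of the depth conditions from residue fields to finite modules over the base. -/

section Devissage

open TensorProduct

/-- No nonzero element of `N` is supported on the zero locus of `I`. -/
def NoSectionsSupported {R : Type*} [CommRing R] (I : Ideal R) (N : Type*) [AddCommGroup N]
    [Module R N] : Prop :=
  ∀ J : Ideal R, I ≤ J.radical → ∀ n : N, (∀ j ∈ J, j • n = 0) → n = 0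

/-- Linear maps into `N` from ideals cosupported on the zero locus of `I` are multiplications. -/
def HomsExtend {R : Type*} [CommRing R] (I : Ideal R) (N : Type*) [AddCommGroup N]
    [Module R N] : Prop :=
  ∀ J : Ideal R, I ≤ J.radical → ∀ φ : J →ₗ[R] N, ∃ n : N, ∀ j : J, φ j = (j : R) • n

variable {R : Type*} [CommRing R] {I : Ideal R}

lemma NoSectionsSupported.of_injective {N N' : Type*} [AddCommGroup N] [Module R N]
    [AddCommGroup N'] [Module R N'] (f : N →ₗ[R] N') (hf : Function.Injective f)
    (h : NoSectionsSupported I N') : NoSectionsSupported I N := by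
  intro J hJ n hn
  apply hf
  rw [map_zero]
  exact h J hJ _ fun j hj => by rw [← map_smul, hn j hj, map_zero]

lemma NoSectionsSupported.of_exact {N₁ N₂ N₃ : Type*} [AddCommGroup N₁] [Module R N₁]
    [AddCommGroup N₂] [Module R N₂] [AddCommGroup N₃] [Module R N₃]
    (f : N₁ →ₗ[R] N₂) (g : N₂ →ₗ[R] N₃) (hf : Function.Injective f) (hfg : Function.Exact f g)
    (h₁ : NoSectionsSupported I N₁) (h₃ : NoSectionsSupported I N₃) :
    NoSectionsSupported I N₂ := by
  intro J hJ n hn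
  obtain ⟨n₁, rfl⟩ := (hfg n).1 (h₃ J hJ _ fun j hj => by rw [← map_smul, hn j hj, map_zero])
  rw [h₁ J hJ n₁ fun j hj => hf (by rw [map_smul, hn j hj, map_zero]), map_zero]

lemma HomsExtend.of_linearEquiv {N N' : Type*} [AddCommGroup N] [Module R N]
    [AddCommGroup N'] [Module R N'] (e : N ≃ₗ[R] N') (h : HomsExtend I N') : HomsExtend I N := by
  intro J hJ φ
  obtain ⟨n, hn⟩ := h J hJ (e.toLinearMap ∘ₗ φ)
  refine ⟨e.symm n, fun j => e.injective ?_⟩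
  simpa using hn j

/-- Subtracting multiplication by a lift of the element found in N₃ leaves a map into N₁. -/
lemma HomsExtend.of_exact {N₁ N₂ N₃ : Type*} [AddCommGroup N₁] [Module R N₁]
    [AddCommGroup N₂] [Module R N₂] [AddCommGroup N₃] [Module R N₃]
    (f : N₁ →ₗ[R] N₂) (g : N₂ →ₗ[R] N₃) (hf : Function.Injective f)
    (hg : Function.Surjective g) (hfg : Function.Exact f g)
    (h₁ : HomsExtend I N₁) (h₃ : HomsExtend I N₃) : HomsExtend I N₂ := by
  intro J hJ φ
  obtain ⟨n₃, hn₃⟩ := h₃ J hJ (g ∘ₗ φ)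
  obtain ⟨n, rfl⟩ := hg n₃
  let ψ : J →ₗ[R] N₂ := φ - (LinearMap.toSpanSingleton R N₂ n) ∘ₗ J.subtype
  have hψ (j : J) : ψ j = φ j - (j : R) • n := rfl
  have hmem (j : J) : ψ j ∈ LinearMap.range f := by
    refine (hfg _).1 ?_
    have := hn₃ j
    rw [LinearMap.comp_apply] at this
    rw [hψ, map_sub, map_smul, this, sub_self]
  obtain ⟨n₁, hn₁⟩ := h₁ J hJ ((LinearEquiv.ofInjective f hf).symm.toLinearMap ∘ₗ
    ψ.codRestrict (LinearMap.range f) hmem)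
  refine ⟨n + f n₁, fun j => ?_⟩
  have h := congrArg (fun x => (LinearEquiv.ofInjective f hf x : N₂)) (hn₁ j)
  simp only [LinearMap.comp_apply, LinearEquiv.coe_coe, LinearEquiv.apply_symm_apply,
    map_smul, LinearMap.codRestrict_apply] at h
  replace h : ψ j = (j : R) • f n₁ := h
  rw [smul_add, ← h, hψ]
  abel

variable {A : Type*} [CommRing A] [Algebra A R] [Module.Flat A R]

/-- The canonical map `R ⊗ A/p → R ⊗ κ(p)`. -/
noncomputable def tensorQuotientToResidueField (R : Type*) [CommRing R] {A : Type*} [CommRing A]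
    [Algebra A R] (p : Ideal A) [p.IsPrime] :
    R ⊗[A] (A ⧸ p) →ₗ[R] R ⊗[A] p.ResidueField :=
  AlgebraTensorModule.lTensor R R (IsScalarTower.toAlgHom A (A ⧸ p) p.ResidueField).toLinearMap

lemma tensorQuotientToResidueField_injective (p : Ideal A) [p.IsPrime] :
    Function.Injective (tensorQuotientToResidueField R p) :=
  Module.Flat.lTensor_preserves_injective_linearMap (M := R)
    (IsScalarTower.toAlgHom A (A ⧸ p) p.ResidueField).toLinearMap
    p.injective_algebraMap_quotient_residueField

lemma NoSectionsSupported.tensor_of_residueField [IsNoetherianRing A]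
    (h : ∀ (p : Ideal A) [p.IsPrime], NoSectionsSupported I (R ⊗[A] p.ResidueField))
    (M : Type*) [AddCommGroup M] [Module A M] [Module.Finite A M] :
    NoSectionsSupported I (R ⊗[A] M) := by
  induction ‹Module.Finite A M› using IsNoetherianRing.induction_on_isQuotientEquivQuotientPrime A with
  | subsingleton N => exact fun J _ n _ => Subsingleton.elim _ _
  | quotient N p e =>
    exact (((h p.asIdeal).of_injective _ (tensorQuotientToResidueField_injective p.asIdeal))).of_injective
      (AlgebraTensorModule.congr (LinearEquiv.refl R R) e).toLinearMap (LinearEquiv.injective _)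
  | exact N₁ N₂ N₃ f g hf hg hfg h₁ h₃ =>
    exact .of_exact (AlgebraTensorModule.lTensor R R f) (AlgebraTensorModule.lTensor R R g)
      (Module.Flat.lTensor_preserves_injective_linearMap (M := R) f hf)
      (lTensor_exact R hfg hg) h₁ h₃

/-- Extension of maps does not pass to submodules, so the inclusion of A/p in κ(p) is not enough by
itself: the denominator of the element found over κ(p) has to be removed. -/
lemma HomsExtend.tensor_quotient [IsNoetherianRing A]
    (h₀ : ∀ (p : Ideal A) [p.IsPrime], NoSectionsSupported I (R ⊗[A] p.ResidueField))
    (p : Ideal A) [p.IsPrime] (h₁ : HomsExtend I (R ⊗[A] p.ResidueField)) :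
    HomsExtend I (R ⊗[A] (A ⧸ p)) := by
  intro J hJ φ
  have hι := tensorQuotientToResidueField_injective (R := R) p
  set ι := tensorQuotientToResidueField R p
  obtain ⟨x, hx⟩ := h₁ J hJ (ι ∘ₗ φ)
  -- Clear denominators: a • x = s ⊗ 1 with a ∉ p. The required element is s ⊗ 1 divided by a, once
  -- divisibility is known.
  obtain ⟨a, ha, s, hs⟩ := Ideal.ResidueField.exists_smul_eq_tmul_one p x
  have hinj : Function.Injective (fun y : R ⊗[A] (A ⧸ p) => a • y) := by
    have h : Function.Injective (LinearMap.lsmul A (A ⧸ p) a) := by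
      intro y z hyz
      obtain ⟨y, rfl⟩ := Ideal.Quotient.mk_surjective y
      obtain ⟨z, rfl⟩ := Ideal.Quotient.mk_surjective z
      have : a * (y - z) ∈ p := by
        rw [mul_sub]
        exact Ideal.Quotient.eq.1 hyz
      exact Ideal.Quotient.eq.2 ((Ideal.IsPrime.mem_or_mem ‹_› this).resolve_left ha)
    have := Module.Flat.lTensor_preserves_injective_linearMap (M := R) _ h
    convert this using 1
    ext y
    induction y with
    | zero => simp
    | add y z hy hz => simp only [smul_add, map_add, hy, hz]
    | tmul r y => simp
  have hb (j : J) : a • φ j = (j : R) • (s ⊗ₜ[A] (1 : A ⧸ p)) := by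
    apply hι
    have h1 : ι (s ⊗ₜ[A] (1 : A ⧸ p)) = s ⊗ₜ[A] (1 : p.ResidueField) := by
      simp [ι, tensorQuotientToResidueField]
    have h2 : ι (a • φ j) = a • ι (φ j) := map_smul (ι.restrictScalars A) a _
    have h3 := hx j
    rw [LinearMap.comp_apply] at h3
    rw [h2, h3, map_smul, h1, ← hs, smul_comm]
  let f := LinearMap.lsmul A (A ⧸ p) a
  have hex : Function.Exact f (LinearMap.range f).mkQ := LinearMap.exact_map_mkQ_range f
  -- Modulo a, the class of s ⊗ 1 is killed by J, because j • (s ⊗ 1) = a • φ j. It therefore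
  -- vanishes, which is the divisibility.
  have hN := NoSectionsSupported.tensor_of_residueField h₀ ((A ⧸ p) ⧸ LinearMap.range f)
  have hb0 := hN J hJ (AlgebraTensorModule.lTensor R R (LinearMap.range f).mkQ (s ⊗ₜ[A] 1))
    fun j hj => by
      rw [← map_smul, ← hb ⟨j, hj⟩]
      refine (((lTensor_exact R hex (Submodule.mkQ_surjective _)) _).2 ?_ :)
      refine ⟨φ ⟨j, hj⟩, ?_⟩
      generalize φ ⟨j, hj⟩ = y
      induction y with
      | zero => simp
      | add y z hy hz => simp only [smul_add, map_add, hy, hz]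
      | tmul r y => simp [f]
  obtain ⟨n, hn⟩ := ((lTensor_exact R hex (Submodule.mkQ_surjective _)) _).1 hb0
  have hn' : a • n = s ⊗ₜ[A] (1 : A ⧸ p) := by
    rw [← hn]
    clear hn
    induction n with
    | zero => simp
    | add y z hy hz => simp only [smul_add, map_add, hy, hz]
    | tmul r y => simp [f]
  refine ⟨n, fun j => hinj ?_⟩
  change a • φ j = a • ((j : R) • n)
  rw [hb, ← hn', smul_comm]

lemma HomsExtend.tensor_of_residueField [IsNoetherianRing A]
    (h₀ : ∀ (p : Ideal A) [p.IsPrime], NoSectionsSupported I (R ⊗[A] p.ResidueField))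
    (h₁ : ∀ (p : Ideal A) [p.IsPrime], HomsExtend I (R ⊗[A] p.ResidueField))
    (M : Type*) [AddCommGroup M] [Module A M] [Module.Finite A M] :
    HomsExtend I (R ⊗[A] M) := by
  induction ‹Module.Finite A M› using IsNoetherianRing.induction_on_isQuotientEquivQuotientPrime A with
  | subsingleton N => exact fun J _ φ => ⟨0, fun j => Subsingleton.elim _ _⟩
  | quotient N p e =>
    exact (HomsExtend.tensor_quotient h₀ p.asIdeal (h₁ p.asIdeal)).of_linearEquiv
      (AlgebraTensorModule.congr (LinearEquiv.refl R R) e)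
  | exact N₁ N₂ N₃ f g hf hg hfg h₁ h₃ =>
    exact .of_exact (AlgebraTensorModule.lTensor R R f) (AlgebraTensorModule.lTensor R R g)
      (Module.Flat.lTensor_preserves_injective_linearMap (M := R) f hf)
      (LinearMap.lTensor_surjective R hg) (lTensor_exact R hfg hg) h₁ h₃

lemma NoSectionsSupported.of_residueField [IsNoetherianRing A]
    (h₀ : ∀ (p : Ideal A) [p.IsPrime], NoSectionsSupported I (R ⊗[A] p.ResidueField)) :
    NoSectionsSupported I R :=
  (NoSectionsSupported.tensor_of_residueField h₀ A).of_injective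
    (AlgebraTensorModule.rid A R R).symm.toLinearMap (LinearEquiv.injective _)

lemma HomsExtend.of_residueField [IsNoetherianRing A]
    (h₀ : ∀ (p : Ideal A) [p.IsPrime], NoSectionsSupported I (R ⊗[A] p.ResidueField))
    (h₁ : ∀ (p : Ideal A) [p.IsPrime], HomsExtend I (R ⊗[A] p.ResidueField)) :
    HomsExtend I R :=
  (HomsExtend.tensor_of_residueField h₀ h₁ A).of_linearEquiv (AlgebraTensorModule.rid A R R).symm

end Devissage

/-! ### Transcendence degree, coprime polynomials and flatness. -/

section Dimension

lemma ringKrullDim_eq_of_isIntegral {A B : Type*} [CommRing A] [CommRing B] [Algebra A B]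
    [Algebra.IsIntegral A B] (h : Function.Injective (algebraMap A B)) :
    ringKrullDim A = ringKrullDim B := by
  apply le_antisymm
  · refine iSup_le fun l => ?_
    obtain ⟨Q, -, hQ, hQl⟩ := Ideal.exists_ideal_over_prime_of_isIntegral (S := B) l.head.asIdeal ⊥
      (by rw [Ideal.comap_bot_of_injective _ h]; exact bot_le)
    have : Q.LiesOver l.head.asIdeal := ⟨hQl.symm⟩
    obtain ⟨L, hL, -⟩ := Ideal.exists_ltSeries_of_hasGoingUp l Q
    rw [← hL]
    exact le_iSup (fun p : LTSeries (PrimeSpectrum B) => (p.length : WithBot ℕ∞)) L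
  · exact Order.krullDim_le_of_strictMono (PrimeSpectrum.comap (algebraMap A B))
      fun P Q hPQ => Ideal.IsIntegral.comap_lt_comap hPQ

/-- Noether normalization: both invariants equal the number of variables. -/
lemma exists_trdeg_eq_ringKrullDim (k D : Type u) [Field k] [CommRing D] [IsDomain D]
    [Algebra k D] [Algebra.FiniteType k D] :
    ∃ s : ℕ, Algebra.trdeg k D = s ∧ ringKrullDim D = s := by
  obtain ⟨s, g, hg, hg'⟩ := exists_integral_inj_algHom_of_fg k D
  algebraize [g.toRingHom]
  have : IsScalarTower k (MvPolynomial (Fin s) k) D := .of_algebraMap_eq' g.comp_algebraMap.symm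
  have : Algebra.IsIntegral (MvPolynomial (Fin s) k) D := ⟨hg'⟩
  have : FaithfulSMul (MvPolynomial (Fin s) k) D := (faithfulSMul_iff_algebraMap_injective _ _).2 hg
  refine ⟨s, ?_, ?_⟩
  · rw [← trdeg_add_eq k (MvPolynomial (Fin s) k), trdeg_eq_zero (R := MvPolynomial (Fin s) k), add_zero,
      MvPolynomial.trdeg_of_isDomain]
    simp
  · rw [← ringKrullDim_eq_of_isIntegral (A := MvPolynomial (Fin s) k) hg,
      MvPolynomial.ringKrullDim_of_isNoetherianRing]
    simp

/-- Some variable X i occurs in f; comparing degrees in X i, no nonzero polynomial in the other m -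
1 variables is a multiple of f, so these stay independent. -/
lemma le_trdeg_quotient_span_singleton_add_one {K : Type u} [Field K] {m : ℕ}
    {f : MvPolynomial (Fin m) K} (hf : ¬ IsUnit f) (hf0 : f ≠ 0) :
    (m : Cardinal) ≤ Algebra.trdeg K (MvPolynomial (Fin m) K ⧸ Ideal.span {f}) + 1 := by
  classical
  obtain ⟨i, hi⟩ : ∃ i, f.degreeOf i ≠ 0 := by
    by_contra! h
    apply hf
    obtain ⟨c, rfl⟩ : ∃ c, f = MvPolynomial.C c := by
      refine ⟨_, MvPolynomial.vars_eq_empty_iff_eq_C.1 ?_⟩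
      exact Finset.eq_empty_of_forall_notMem fun i hi =>
        MvPolynomial.mem_vars_iff_degreeOf_ne_zero.1 hi (h i)
    have : c ≠ 0 := by rintro rfl; simp at hf0
    exact (IsUnit.mk0 c this).map MvPolynomial.C
  let x : {j : Fin m // j ≠ i} → MvPolynomial (Fin m) K ⧸ Ideal.span {f} :=
    fun j => Ideal.Quotient.mk _ (MvPolynomial.X j.1)
  have hx : AlgebraicIndependent K x := by
    refine (injective_iff_map_eq_zero _).2 fun h hh => ?_
    have h1 : MvPolynomial.aeval x h =
        Ideal.Quotient.mkₐ K (Ideal.span {f}) (MvPolynomial.rename Subtype.val h) := by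
      rw [← AlgHom.comp_apply]
      congr 1
      ext j
      simp only [x, AlgHom.comp_apply, MvPolynomial.aeval_X, MvPolynomial.rename_X,
        Ideal.Quotient.mkₐ_eq_mk]
    rw [h1, Ideal.Quotient.mkₐ_eq_mk, Ideal.Quotient.eq_zero_iff_mem,
      Ideal.mem_span_singleton] at hh
    by_contra h0
    obtain ⟨q, hq⟩ := hh
    have h0' : MvPolynomial.rename Subtype.val h ≠ 0 := fun e =>
      h0 (MvPolynomial.rename_injective _ Subtype.val_injective (by rw [e, map_zero]))
    have hd : (MvPolynomial.rename Subtype.val h).degreeOf i = 0 := by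
      by_contra hd
      have := MvPolynomial.mem_vars_iff_degreeOf_ne_zero.2 hd
      have := MvPolynomial.vars_rename _ _ this
      simp at this
    have hq0 : q ≠ 0 := by rintro rfl; exact h0' (by rw [hq, mul_zero])
    rw [hq, MvPolynomial.degreeOf_mul_eq hf0 hq0] at hd
    omega
  have := hx.lift_cardinalMk_le_trdeg
  have hc : (Cardinal.mk {j : Fin m // j ≠ i} : Cardinal.{0}) + 1 = m := by
    have : Fintype.card {j : Fin m // j ≠ i} + 1 = m := by
      have h1 := Fintype.card_subtype_compl (fun j : Fin m => j = i)
      simp only [Fintype.card_fin, Fintype.card_subtype_eq] at h1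
      have h2 := i.2
      change Fintype.card {j : Fin m // ¬ j = i} + 1 = m
      omega
    rw [Cardinal.mk_fintype]
    exact_mod_cast this
  have h2 : Cardinal.lift.{u} (Cardinal.mk {j : Fin m // j ≠ i}) + 1 = m := by
    simpa using congrArg Cardinal.lift.{u} hc
  rw [Cardinal.lift_uzero] at this
  rw [← h2]
  gcongr

/-- Prime avoidance: after choosing f, take g outside all the prime ideals generated by factors of
f. -/
lemma exists_isRelPrime_mem {P : Type*} [CommRing P] [IsDomain P] [UniqueFactorizationMonoid P]
    (a : Ideal P) (ha : a ≠ ⊥) (h : ∀ f : P, Irreducible f → ¬ a ≤ Ideal.span {f}) :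
    ∃ f ∈ a, ∃ g ∈ a, f ≠ 0 ∧ IsRelPrime f g := by
  classical
  obtain ⟨f, hfa, hf0⟩ := Submodule.exists_mem_ne_zero_of_ne_bot ha
  let s := (UniqueFactorizationMonoid.factors f).toFinset
  have hirr (z) (hz : z ∈ s) : Irreducible z :=
    UniqueFactorizationMonoid.irreducible_of_factor z (Multiset.mem_toFinset.1 hz)
  have hs : ¬ (a : Set P) ⊆ ⋃ i ∈ (s : Set P), Ideal.span {i} := by
    rw [Ideal.subset_union_prime (f := fun i => Ideal.span {i}) 0 0 fun i hi _ _ =>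
      (Ideal.span_singleton_prime (hirr i hi).ne_zero).2 (hirr i hi).prime]
    rintro ⟨i, hi, hai⟩
    exact h i (hirr i hi) hai
  obtain ⟨g, hg, hgs⟩ := Set.not_subset.1 hs
  refine ⟨f, hfa, g, hg, hf0, WfDvdMonoid.isRelPrime_of_no_irreducible_factors
    (fun h => hf0 h.1) fun z hz hzf hzg => hgs ?_⟩
  obtain ⟨q, hq, hzq⟩ := UniqueFactorizationMonoid.exists_mem_factors_of_dvd hf0 hz hzf
  simp only [Set.mem_iUnion]
  exact ⟨q, Multiset.mem_toFinset.2 hq, Ideal.mem_span_singleton.2 (hzq.symm.dvd.trans hzg)⟩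

/-- By the equational criterion of flatness the relation comes from syzygies of (g, -f) over P, and
coprimality makes their first entries divisible by f. -/
lemma dvd_of_flat_of_isRelPrime {P C : Type*} [CommRing P] [IsDomain P]
    [UniqueFactorizationMonoid P] [CommRing C]
    [Algebra P C] [Module.Flat P C] {f g : P} (hfg : IsRelPrime f g) {c c' : C}
    (h : g • c = f • c') : ∃ n, c = f • n := by
  have h1 : ∑ i, (![g, -f] : Fin 2 → P) i • (![c, c'] : Fin 2 → C) i = 0 := by
    simp [Fin.sum_univ_two, h]
  obtain ⟨k, a, y, hy, ha⟩ := Module.Flat.isTrivialRelation_of_sum_smul_eq_zero (R := P) (M := C) h1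
  have hd (j) : f ∣ a 0 j := by
    have := ha j
    simp only [Fin.sum_univ_two, Matrix.cons_val_zero, Matrix.cons_val_one] at this
    refine hfg.dvd_of_dvd_mul_left ⟨a 1 j, ?_⟩
    linear_combination this
  choose b hb using hd
  refine ⟨∑ j, b j • y j, ?_⟩
  rw [show c = ∑ j, a 0 j • y j from hy 0, Finset.smul_sum]
  exact Finset.sum_congr rfl fun j _ => by rw [hb, mul_smul]

lemma smul_left_cancel_of_flat {P C : Type*} [CommRing P] [IsDomain P] [CommRing C]
    [Algebra P C] [Module.Flat P C] {f : P} (hf : f ≠ 0) {c c' : C} (h : f • c = f • c') :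
    c = c' :=
  Module.Flat.isSMulRegular_of_nonZeroDivisors (M := C) (mem_nonZeroDivisors_of_ne_zero hf) h

end Dimension

/-! ### Depth on a ring flat over a factorial domain. -/

section Fibre

variable {R C : Type*} [CommRing R] [CommRing C] [Algebra R C] {I : Ideal R}
  {P : Type*} [CommRing P] [IsDomain P] [UniqueFactorizationMonoid P] [Algebra P C]
  [Module.Flat P C]

lemma forall_smul_eq_zero_of_mem_map {J : Ideal R} {n : C} (hn : ∀ j ∈ J, j • n = 0) {c : C}
    (hc : c ∈ J.map (algebraMap R C)) : c * n = 0 := by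
  refine Submodule.span_induction (p := fun c _ => c * n = 0) ?_ (zero_mul n)
    (fun x y _ _ hx hy => by rw [add_mul, hx, hy, add_zero])
    (fun a x _ hx => by rw [smul_eq_mul, mul_assoc, hx, mul_zero]) hc
  rintro _ ⟨j, hj, rfl⟩
  rw [← Algebra.smul_def, hn j hj]

omit [UniqueFactorizationMonoid P] in
lemma NoSectionsSupported.of_flat (h : ∀ J : Ideal R, I ≤ J.radical →
    ∃ f : P, f ≠ 0 ∧ algebraMap P C f ∈ J.map (algebraMap R C)) : NoSectionsSupported I C := by
  intro J hJ n hn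
  obtain ⟨f, hf0, hf⟩ := h J hJ
  refine smul_left_cancel_of_flat hf0 ?_
  rw [smul_zero, Algebra.smul_def, forall_smul_eq_zero_of_mem_map hn hf]

lemma HomsExtend.of_flat (h : ∀ J : Ideal R, I ≤ J.radical → ∃ f g : P, f ≠ 0 ∧
    IsRelPrime f g ∧ algebraMap P C f ∈ J.map (algebraMap R C) ∧
      algebraMap P C g ∈ J.map (algebraMap R C)) : HomsExtend I C := by
  intro J hJ φ
  obtain ⟨f, g, hf0, hfg, hf, hg⟩ := h J hJ
  -- Each c in the extension of J makes c * φ a multiplication: for c the image of i ∈ J the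
  -- multiplier is φ i, since j • φ i = i • φ j.
  have key {c : C} (hc : c ∈ J.map (algebraMap R C)) : ∃ d : C, ∀ j : J, (j : R) • d = c * φ j := by
    refine Submodule.span_induction (p := fun c _ => ∃ d : C, ∀ j : J, (j : R) • d = c * φ j) ?_
      ⟨0, by simp⟩ ?_ ?_ hc
    · rintro _ ⟨i, hi, rfl⟩
      refine ⟨φ ⟨i, hi⟩, fun j => ?_⟩
      rw [← Algebra.smul_def, ← map_smul, ← map_smul]
      congr 1
      exact Subtype.ext (mul_comm _ _)
    · rintro x y _ _ ⟨d, hd⟩ ⟨e, he⟩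
      exact ⟨d + e, fun j => by rw [smul_add, hd, he, add_mul]⟩
    · rintro a x _ ⟨d, hd⟩
      exact ⟨a * d, fun j => by rw [← mul_smul_comm j.1 a d, hd, smul_eq_mul, mul_assoc]⟩
  obtain ⟨F, hF⟩ := key hf
  obtain ⟨G, hG⟩ := key hg
  -- F and G are the multipliers for f * φ and g * φ, so J kills g • F - f • G. Then F = f • n, and
  -- n is the multiplier for φ.
  have hFG : g • F = f • G := by
    rw [← sub_eq_zero]
    refine NoSectionsSupported.of_flat (P := P) (I := I) (fun J hJ => ?_) J hJ _ fun j hj => ?_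
    · obtain ⟨f, g, hf0, -, hf, -⟩ := h J hJ
      exact ⟨f, hf0, hf⟩
    · have h1 := hF ⟨j, hj⟩
      have h2 := hG ⟨j, hj⟩
      simp only [Algebra.smul_def] at h1 h2 ⊢
      linear_combination algebraMap P C g * h1 - algebraMap P C f * h2
  obtain ⟨n, hn⟩ := dvd_of_flat_of_isRelPrime hfg hFG
  refine ⟨n, fun j => smul_left_cancel_of_flat hf0 ?_⟩
  have := hF j
  rw [hn] at this
  rw [Algebra.smul_def, ← this]
  simp only [Algebra.smul_def]
  ring

lemma exists_isRelPrime_of_ringKrullDim_le {K C : Type u} [Field K] [CommRing C] {m d : ℕ}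
    (hd : d + 2 ≤ m) [Algebra K C] [Algebra.FiniteType K C] [Algebra (MvPolynomial (Fin m) K) C]
    [IsScalarTower K (MvPolynomial (Fin m) K) C] (J : Ideal C)
    (hJ : ∀ Q : Ideal C, Q.IsPrime → J ≤ Q → ringKrullDim (C ⧸ Q) ≤ d) :
    ∃ f g : MvPolynomial (Fin m) K, f ≠ 0 ∧ IsRelPrime f g ∧
      algebraMap _ C f ∈ J ∧ algebraMap _ C g ∈ J := by
  let P := MvPolynomial (Fin m) K
  let a : Ideal P := J.comap (algebraMap P C)
  have key (b : Ideal P) (hb : b.IsPrime) (hab : a ≤ b) : Algebra.trdeg K (P ⧸ b) ≤ d := by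
    -- A minimal prime over the contracted ideal is itself contracted from a prime over J, where the
    -- dimension bound applies.
    obtain ⟨p, hp, hpb⟩ := Ideal.exists_minimalPrimes_le hab
    obtain ⟨Q, hQ, hJQ, rfl⟩ := Ideal.exists_comap_eq_of_mem_minimalPrimes _ p hp
    obtain ⟨s, hs, hs'⟩ := exists_trdeg_eq_ringKrullDim K (C ⧸ Q)
    have hsd : s ≤ d := by
      have := hJ Q hQ hJQ
      rw [hs'] at this
      exact_mod_cast this
    calc Algebra.trdeg K (P ⧸ b) ≤ Algebra.trdeg K (P ⧸ Q.comap (algebraMap P C)) :=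
          trdeg_le_of_surjective (Ideal.Quotient.factorₐ K hpb)
            (Ideal.Quotient.factor_surjective hpb)
      _ ≤ Algebra.trdeg K (C ⧸ Q) :=
          trdeg_le_of_injective (Ideal.quotientMapₐ Q (IsScalarTower.toAlgHom K P C) le_rfl)
            Ideal.quotientMap_injective
      _ ≤ d := by rw [hs]; exact_mod_cast hsd
  -- The zero ideal has transcendence degree m, and a principal prime at least m - 1; both exceed d,
  -- so neither kind contains `a`.
  obtain ⟨f, hf, g, hg, hf0, hfg⟩ := exists_isRelPrime_mem a (fun ha => by
      have h1 := key ⊥ Ideal.isPrime_bot ha.le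
      have h2 := trdeg_le_of_injective (R := K)
        (AlgEquiv.quotientBot K P).symm.toAlgHom (AlgEquiv.injective _)
      rw [MvPolynomial.trdeg_of_isDomain] at h2
      have := h2.trans h1
      simp only [Cardinal.mk_fin, Cardinal.lift_natCast, Nat.cast_le] at this
      omega)
    (fun f hf haf => by
      have h1 := key _ ((Ideal.span_singleton_prime hf.ne_zero).2 hf.prime) haf
      have h2 := (le_trdeg_quotient_span_singleton_add_one hf.not_isUnit hf.ne_zero).trans
        (add_le_add_left h1 1)
      have : m ≤ d + 1 := by exact_mod_cast h2
      omega)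
  exact ⟨f, g, hf0, hfg, hf, hg⟩

end Fibre

/-! ### From fibre dimension to depth. -/

section FibreDimension

open TensorProduct

lemma flat_mvPolynomial_tensor {A R K : Type u} [CommRing A] [CommRing R] [CommRing K]
    [Algebra A R] [Algebra A K] {m : ℕ} (g : MvPolynomial (Fin m) A →ₐ[A] R) (hg : g.Flat) :
    ((Algebra.TensorProduct.lTensor (S := K) K g).comp
      (MvPolynomial.algebraTensorAlgEquiv A K).symm.toAlgHom).Flat :=
  RingHom.Flat.comp (.of_bijective (AlgEquiv.bijective _)) (hg.lTensor K)

attribute [local instance] Algebra.TensorProduct.rightAlgebra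

variable {A R : Type u} [CommRing A] [CommRing R] [Algebra A R] [Algebra.FiniteType A R]
  {I : Ideal R} {m d : ℕ} (g : MvPolynomial (Fin m) A →ₐ[A] R) (hg : g.Flat) (hd : d + 2 ≤ m)

omit [Algebra.FiniteType A R] in
lemma isInducing_comap_fiber (p : PrimeSpectrum A) :
    Topology.IsInducing (PrimeSpectrum.comap (algebraMap R (p.asIdeal.Fiber R))) :=
  Topology.IsInducing.subtypeVal.comp (PrimeSpectrum.preimageHomeomorphFiber A R p).symm.isInducing

omit [Algebra.FiniteType A R] in
lemma comap_fiber_eq (p : PrimeSpectrum A) (q : PrimeSpectrum (p.asIdeal.Fiber R)) :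
    PrimeSpectrum.comap (algebraMap A R)
      (PrimeSpectrum.comap (algebraMap R (p.asIdeal.Fiber R)) q) = p :=
  ((PrimeSpectrum.preimageHomeomorphFiber A R p).symm q).2

lemma ringKrullDim_quotient_le_of_isInducing {R C : Type*} [CommRing R] [CommRing C] (φ : R →+* C)
    (hφ : Topology.IsInducing (PrimeSpectrum.comap φ)) (Q : Ideal C) (S : Set (PrimeSpectrum R))
    (hS : ∀ q : PrimeSpectrum C, Q ≤ q.asIdeal → PrimeSpectrum.comap φ q ∈ S) :
    ringKrullDim (C ⧸ Q) ≤ topologicalKrullDim S := by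
  rw [← PrimeSpectrum.topologicalKrullDim_eq_ringKrullDim]
  have hf := hφ.comp
    (PrimeSpectrum.isEmbedding_comap_of_surjective _ _ (Ideal.Quotient.mk_surjective (I := Q))).isInducing
  refine (hf.codRestrict (s := S) fun x => hS _ fun c hc => ?_).topologicalKrullDim_le
  change Ideal.Quotient.mk Q c ∈ x.asIdeal
  rw [Ideal.Quotient.eq_zero_iff_mem.2 hc]
  exact zero_mem _

omit [Algebra.FiniteType A R] in
lemma ringKrullDim_quotient_fiber_le (p : PrimeSpectrum A)
    (hp : topologicalKrullDim {q : PrimeSpectrum R | I ≤ q.asIdeal ∧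
      PrimeSpectrum.comap (algebraMap A R) q = p} ≤ d)
    (Q : Ideal (p.asIdeal.Fiber R))
    (hIQ : I ≤ Q.comap (algebraMap R (p.asIdeal.Fiber R))) :
    ringKrullDim (p.asIdeal.Fiber R ⧸ Q) ≤ d := by
  refine le_trans (ringKrullDim_quotient_le_of_isInducing _ (isInducing_comap_fiber p) Q _ ?_) hp
  exact fun q hq => ⟨hIQ.trans (Ideal.comap_mono hq), comap_fiber_eq p q⟩

include hg hd in
lemma exists_isRelPrime_fiber (p : PrimeSpectrum A)
    (hp : topologicalKrullDim {q : PrimeSpectrum R | I ≤ q.asIdeal ∧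
      PrimeSpectrum.comap (algebraMap A R) q = p} ≤ d) :
    NoSectionsSupported I (R ⊗[A] p.asIdeal.ResidueField) ∧
      HomsExtend I (R ⊗[A] p.asIdeal.ResidueField) := by
  let K := p.asIdeal.ResidueField
  let C := p.asIdeal.Fiber R
  let G := (Algebra.TensorProduct.lTensor (S := K) K g).comp
      (MvPolynomial.algebraTensorAlgEquiv A K).symm.toAlgHom
  have hG : G.Flat := flat_mvPolynomial_tensor g hg
  let : Algebra (MvPolynomial (Fin m) K) C := G.toAlgebra
  have : IsScalarTower K (MvPolynomial (Fin m) K) C := .of_algebraMap_eq' G.comp_algebraMap.symm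
  have : Module.Flat (MvPolynomial (Fin m) K) C := hG
  have key (J : Ideal R) (hJ : I ≤ J.radical) := exists_isRelPrime_of_ringKrullDim_le (K := K) hd
    (J.map (algebraMap R C)) fun Q hQ hJQ => by
      refine ringKrullDim_quotient_fiber_le p hp Q (hJ.trans ?_)
      rw [Ideal.map_le_iff_le_comap] at hJQ
      exact (hQ.comap (algebraMap R C)).radical_le_iff.2 hJQ
  let e : R ⊗[A] K ≃ₐ[R] C := Algebra.TensorProduct.commRight A R K
  constructor
  · refine NoSectionsSupported.of_injective e.toLinearMap e.injective ?_
    refine .of_flat (P := MvPolynomial (Fin m) K) fun J hJ => ?_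
    obtain ⟨f, -, hf0, -, hf, -⟩ := key J hJ
    exact ⟨f, hf0, hf⟩
  · refine HomsExtend.of_linearEquiv e.toLinearEquiv ?_
    refine .of_flat (P := MvPolynomial (Fin m) K) fun J hJ => ?_
    exact key J hJ

include hg hd in
/-- If `R` is flat over a polynomial ring in `m` variables over `A` and the closed subset `V(I)` has
fibres of dimension at most `m - 2` over `A`, then `R` has depth at least two along `V(I)`. -/
theorem homsExtend_of_fibre_dimension_le [IsNoetherianRing A]
    (h : ∀ p : PrimeSpectrum A, topologicalKrullDim {q : PrimeSpectrum R | I ≤ q.asIdeal ∧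
      PrimeSpectrum.comap (algebraMap A R) q = p} ≤ d) :
    NoSectionsSupported I R ∧ HomsExtend I R := by
  have : Module.Flat A R := by
    have : (algebraMap A R).Flat := by
      rw [← g.comp_algebraMap]
      exact RingHom.Flat.comp (RingHom.flat_algebraMap_iff.2 inferInstance) hg
    exact RingHom.flat_algebraMap_iff.1 this
  have h₀ (p : Ideal A) [hp : p.IsPrime] := exists_isRelPrime_fiber g hg hd ⟨p, hp⟩ (h ⟨p, hp⟩)
  exact ⟨.of_residueField fun p _ => (h₀ p).1,
    .of_residueField (fun p _ => (h₀ p).1) fun p _ => (h₀ p).2⟩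

end FibreDimension

/-! ### Dimension bounds for rings étale over affine space. -/

section ChartDimension

lemma isAlgebraic_of_quasiFinite {A D : Type u} [CommRing A] [IsDomain A] [CommRing D] [IsDomain D]
    [Algebra A D] [FaithfulSMul A D] [Algebra.QuasiFinite A D] : Algebra.IsAlgebraic A D := by
  have : Algebra.QuasiFinite A (FractionRing D) := .trans _ D _
  have : FaithfulSMul A (FractionRing D) := .trans A D _
  let : Algebra (FractionRing A) (FractionRing D) := FractionRing.liftAlgebra _ _
  have : Algebra.QuasiFinite (FractionRing A) (FractionRing D) := .of_restrictScalars A _ _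
  have : Module.Finite (FractionRing A) (FractionRing D) := .of_quasiFinite
  have : Algebra.IsAlgebraic A (FractionRing D) :=
    (IsFractionRing.comap_isAlgebraic_iff (K := FractionRing A)).2 inferInstance
  exact .tower_bot_of_injective (A := FractionRing D) (IsFractionRing.injective D _)

lemma trdeg_quotient_le_of_quasiFinite {k O : Type u} [Field k] [CommRing O] [Algebra k O] {m : ℕ}
    [Algebra (MvPolynomial (Fin m) k) O] [IsScalarTower k (MvPolynomial (Fin m) k) O]
    [Algebra.QuasiFinite (MvPolynomial (Fin m) k) O] (q : Ideal O) [q.IsPrime] :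
    Algebra.trdeg k (O ⧸ q) ≤ m := by
  let P := MvPolynomial (Fin m) k
  let p : Ideal P := q.comap (algebraMap P O)
  have hp : q.LiesOver p := ⟨rfl⟩
  have : Algebra.QuasiFinite P (O ⧸ q) := .trans _ O _
  have : Algebra.QuasiFinite (P ⧸ p) (O ⧸ q) := .of_restrictScalars P _ _
  have : FaithfulSMul (P ⧸ p) (O ⧸ q) := inferInstance
  have := isAlgebraic_of_quasiFinite (A := P ⧸ p) (D := O ⧸ q)
  have : IsScalarTower k (P ⧸ p) (O ⧸ q) := .to₁₃₄ k P (P ⧸ p) (O ⧸ q)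
  rw [← trdeg_add_eq k (P ⧸ p), trdeg_eq_zero (R := P ⧸ p), add_zero]
  refine (trdeg_le_of_surjective (Ideal.Quotient.mkₐ k p)
    (Ideal.Quotient.mkₐ_surjective k p)).trans ?_
  rw [MvPolynomial.trdeg_of_isDomain]
  simp

lemma ringKrullDim_le_of_injective_quotient {k O D : Type u} [Field k] [CommRing O] [Algebra k O]
    {m : ℕ} (g : MvPolynomial (Fin m) k →ₐ[k] O) (hg : g.Etale) (q : Ideal O) [q.IsPrime]
    [CommRing D] [Algebra k D] [Algebra.FiniteType k D]
    (f : D →ₐ[k] O ⧸ q) (hf : Function.Injective f) : ringKrullDim D ≤ m := by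
  have := hf.isDomain f.toRingHom
  algebraize [g.toRingHom]
  have : IsScalarTower k (MvPolynomial (Fin m) k) O := .of_algebraMap_eq' g.comp_algebraMap.symm
  have : Algebra.Etale (MvPolynomial (Fin m) k) O := hg
  obtain ⟨s, hs, hs'⟩ := exists_trdeg_eq_ringKrullDim k D
  have h := (trdeg_le_of_injective f hf).trans (trdeg_quotient_le_of_quasiFinite (m := m) q)
  rw [hs] at h
  rw [hs']
  exact_mod_cast h

/-- The dimension of a space is detected on an open neighbourhood of some point. -/
lemma exists_point_le_topologicalKrullDim {T : Type*} [TopologicalSpace T] {n : ℕ}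
    (hn : (n : WithBot ℕ∞) ≤ topologicalKrullDim T) :
    ∃ t : T, ∀ (S : Type _) [TopologicalSpace S] (f : S → T), Topology.IsOpenEmbedding f →
      t ∈ Set.range f → (n : WithBot ℕ∞) ≤ topologicalKrullDim S := by
  obtain ⟨l, hl⟩ := Order.le_krullDim_iff.1 hn
  -- A point of the smallest member lies in the whole chain, so every open neighbourhood of it meets
  -- all members.
  obtain ⟨t, ht⟩ := l.head.2.nonempty
  refine ⟨t, fun S _ f hf htf => ?_⟩
  let Z := (TopologicalSpace.IrreducibleCloseds.orderIsoOfIsOpenEmbedding f hf).symm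
    ⟨l.head, by obtain ⟨s, hs⟩ := htf; exact ⟨s, by rw [Set.mem_preimage, hs]; exact ht⟩⟩
  have h1 : Order.coheight Z = Order.coheight l.head := by
    rw [← hf.coheight_map Z]
    congr 1
    exact congrArg Subtype.val
      ((TopologicalSpace.IrreducibleCloseds.orderIsoOfIsOpenEmbedding f hf).apply_symm_apply _)
  refine le_trans ?_ (Order.coheight_le_krullDim Z)
  rw [h1, ← hl]
  exact_mod_cast Order.length_le_coheight_head

end ChartDimension

/-! ### Étale coordinates and their number. -/

section Charts

/-- An affine chart `ι : Spec D ⟶ Y` over `k` with étale coordinates in `m` variables. -/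
structure EtaleChart {k : Type u} [CommRing k] {Y : Scheme.{u}}
    (pY : Y ⟶ Spec (CommRingCat.of k)) (m : ℕ) where
  D : CommRingCat.{u}
  ι : Spec D ⟶ Y
  [isOpenImmersion : IsOpenImmersion ι]
  φ : CommRingCat.of k ⟶ D
  comp_eq : ι ≫ pY = Spec.map φ
  coord : MvPolynomial (Fin m) k →+* D
  coord_comp : coord.comp MvPolynomial.C = φ.hom
  etale : coord.Etale

attribute [instance] EtaleChart.isOpenImmersion

variable {k : Type u} [Field k] {Y : Scheme.{u}} (pY : Y ⟶ Spec (CommRingCat.of k))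

lemma exists_affine_over {X : Scheme.{u}} {A : CommRingCat.{u}} (f : X ⟶ Spec A) {x : X}
    {O : X.Opens} (hx : x ∈ O) :
    ∃ (D : CommRingCat.{u}) (ι : Spec D ⟶ X) (φ : A ⟶ D), IsOpenImmersion ι ∧ x ∈ Set.range ι ∧
      Set.range ι ⊆ O ∧ ι ≫ f = Spec.map φ := by
  obtain ⟨D, ι, hι, hxι, hιO⟩ := Scheme.exists_affine_mem_range_and_range_subset hx
  exact ⟨D, ι, Spec.preimage (ι ≫ f), hι, hxι, hιO, by simp⟩

lemma exists_etaleChart [Smooth pY] (y : Y) :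
    ∃ (m : ℕ) (c : EtaleChart pY m), y ∈ Set.range c.ι := by
  obtain ⟨D, ι, φ, hι, ⟨z, rfl⟩, -, hφ⟩ := exists_affine_over pY (O := ⊤) (x := y) trivial
  have hs : Smooth (Spec.map φ) := hφ ▸ inferInstance
  rw [HasRingHomProperty.Spec_iff (P := @Smooth), RingHom.smooth_iff_locally_isStandardSmooth] at hs
  obtain ⟨s, hs, h⟩ := hs
  obtain ⟨t, hts, htz⟩ : ∃ t ∈ s, t ∉ z.asIdeal := by
    by_contra! hc
    exact z.2.ne_top (eq_top_iff.2 (hs ▸ Ideal.span_le.2 hc))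
  obtain ⟨m, g, hg, hg'⟩ := (h t hts).exists_etale_mvPolynomial
  let loc : D ⟶ CommRingCat.of (Localization.Away t) :=
    CommRingCat.ofHom (algebraMap D (Localization.Away t))
  have : IsOpenImmersion (Spec.map loc) := IsOpenImmersion.of_isLocalization t
  refine ⟨m, ⟨.of (Localization.Away t), Spec.map loc ≫ ι, φ ≫ loc, ?_, g, hg, hg'⟩, ?_⟩
  · rw [Category.assoc, hφ, Spec.map_comp]
  · have : z ∈ Set.range (PrimeSpectrum.comap (algebraMap D (Localization.Away t))) := by
      rw [PrimeSpectrum.localization_away_comap_range _ t]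
      exact htz
    obtain ⟨w, hw⟩ := this
    exact ⟨w, (Scheme.Hom.comp_apply (Spec.map loc) ι w).trans (congrArg ι hw)⟩

lemma topologicalKrullDim_le_of_forall_specializes {D : CommRingCat.{u}} (q : Spec D)
    (S : Set (Spec D)) (hS : ∀ s ∈ S, q ⤳ s) :
    topologicalKrullDim S ≤ ringKrullDim (D ⧸ q.asIdeal) := by
  have he := PrimeSpectrum.isEmbedding_comap_of_surjective _ _
    (Ideal.Quotient.mk_surjective (I := q.asIdeal))
  rw [← PrimeSpectrum.topologicalKrullDim_eq_ringKrullDim]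
  have hmem (s : S) : s.1 ∈ Set.range (PrimeSpectrum.comap (Ideal.Quotient.mk q.asIdeal)) := by
    rw [range_comap_of_surjective _ _ Ideal.Quotient.mk_surjective, Ideal.mk_ker]
    exact (PrimeSpectrum.le_iff_specializes _ _).2 (hS s.1 s.2)
  exact (he.toHomeomorph.symm.isInducing.comp
    ((Topology.IsInducing.subtypeVal (t := S)).codRestrict hmem)).topologicalKrullDim_le

/-- The dimension n of a component may be attained only away from the chart. Its generic point lies
both in the chart and in an affine open where n is attained, and transcendence degree there compares
the two. -/
lemma le_of_etaleChart [LocallyOfFiniteType pY] {n : ℕ} (hdim : IsPureDim Y n) {m : ℕ}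
    (c : EtaleChart pY m) (y : Spec c.D) : n ≤ m := by
  obtain ⟨W, hW, hyW⟩ : ∃ W ∈ irreducibleComponents Y, c.ι y ∈ W :=
    ⟨_, irreducibleComponent_mem_irreducibleComponents _, mem_irreducibleComponent⟩
  obtain ⟨t, ht⟩ := exists_point_le_topologicalKrullDim (hdim W hW).ge
  obtain ⟨D', ι', φ', hι', ⟨z, hz⟩, -, hφ'⟩ := exists_affine_over pY (O := ⊤) (x := t.1) trivial
  have hirr : IsIrreducible W := hW.1
  have hcl : IsClosed W := isClosed_of_mem_irreducibleComponents W hW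
  have hη := hirr.isGenericPoint_genericPoint hcl
  set η := hirr.genericPoint
  have hmem {x : Y} (hx : x ∈ W) : η ⤳ x := hη.specializes hx
  obtain ⟨q', hq'⟩ : η ∈ Set.range ι' :=
    (hmem t.2).mem_open ι'.isOpenEmbedding.isOpen_range ⟨z, hz⟩
  obtain ⟨q, hq⟩ : η ∈ Set.range c.ι :=
    (hmem hyW).mem_open c.ι.isOpenEmbedding.isOpen_range ⟨y, rfl⟩
  have h1 : (n : WithBot ℕ∞) ≤ topologicalKrullDim (ι' ⁻¹' W) :=
    ht _ (W.restrictPreimage ι') (ι'.isOpenEmbedding.restrictPreimage W)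
      ⟨⟨z, by rw [Set.mem_preimage, hz]; exact t.2⟩, Subtype.ext hz⟩
  have h2 : topologicalKrullDim (ι' ⁻¹' W) ≤ ringKrullDim (D' ⧸ q'.asIdeal) :=
    topologicalKrullDim_le_of_forall_specializes q' _ fun s hs => by
      rw [← ι'.isOpenEmbedding.isInducing.specializes_iff, hq']
      exact hmem hs
  obtain ⟨w, hw1, hw2⟩ := Scheme.Pullback.exists_preimage_pullback (f := c.ι) (g := ι') q q'
    (hq.trans hq'.symm)
  obtain ⟨O, j, hj, ⟨v, hv⟩, -⟩ := Scheme.exists_affine_mem_range_and_range_subset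
    (U := (⊤ : (pullback c.ι ι').Opens)) (x := w) trivial
  let a : c.D ⟶ O := Spec.preimage (j ≫ pullback.fst c.ι ι')
  let a' : D' ⟶ O := Spec.preimage (j ≫ pullback.snd c.ι ι')
  have ha : Spec.map a = j ≫ pullback.fst c.ι ι' := Spec.map_preimage _
  have ha' : Spec.map a' = j ≫ pullback.snd c.ι ι' := Spec.map_preimage _
  have haE : a.hom.Etale := by
    have : Etale (Spec.map a) := by rw [ha]; infer_instance
    exact (HasRingHomProperty.Spec_iff (P := @Etale)).1 this
  have haa' : c.φ ≫ a = φ' ≫ a' := by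
    apply Spec.map_injective
    rw [Spec.map_comp, Spec.map_comp, ← c.comp_eq, ← hφ', ha, ha', Category.assoc, Category.assoc,
      pullback.condition_assoc]
  have hv' : (Spec.map a') v = q' := by
    rw [ha', Scheme.Hom.comp_apply, hv, hw2]
  have hft : φ'.hom.FiniteType := by
    have : LocallyOfFiniteType (Spec.map φ') := hφ' ▸ inferInstance
    exact (HasRingHomProperty.Spec_iff (P := @LocallyOfFiniteType)).1 this
  let : Algebra k D' := φ'.hom.toAlgebra
  let : Algebra k O := (φ' ≫ a').hom.toAlgebra
  have : Algebra.FiniteType k D' := hft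
  let g : MvPolynomial (Fin m) k →ₐ[k] O :=
    { toRingHom := a.hom.comp c.coord
      commutes' := fun r => by
        change a.hom (c.coord (MvPolynomial.C r)) = (φ' ≫ a').hom r
        rw [← haa']
        exact congrArg a.hom (congrArg (fun f : k →+* c.D => f r) c.coord_comp) }
  have hg : g.Etale := RingHom.Etale.stableUnderComposition _ _ c.etale haE
  let b : D' →ₐ[k] O := { toRingHom := a'.hom, commutes' := fun r => rfl }
  have hq'v : q'.asIdeal = v.asIdeal.comap a'.hom := congrArg PrimeSpectrum.asIdeal hv'.symm
  have hv_prime : v.asIdeal.IsPrime := PrimeSpectrum.isPrime v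
  let f : (D' ⧸ q'.asIdeal) →ₐ[k] O ⧸ v.asIdeal := Ideal.quotientMapₐ v.asIdeal b hq'v.le
  have hf : Function.Injective f := Ideal.quotientMap_injective' (H := hq'v.le) hq'v.ge
  have h3 := ringKrullDim_le_of_injective_quotient g hg v.asIdeal f hf
  exact_mod_cast (h1.trans h2).trans h3

end Charts

/-! ### Extension of functions across a closed set. -/

section Sections

open TopologicalSpace

variable {X : Scheme.{u}}

/-- Restriction of functions, as a ring homomorphism. -/
def restrictSections {U V : X.Opens} (h : U ≤ V) : Γ(X, V) →+* Γ(X, U) :=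
  (X.presheaf.map (homOfLE h).op).hom

@[simp]
lemma restrictSections_restrictSections {U V W : X.Opens} (h : U ≤ V) (h' : V ≤ W) (s : Γ(X, W)) :
    restrictSections h (restrictSections h' s) = restrictSections (h.trans h') s := by
  rw [restrictSections, restrictSections, restrictSections, ← CommRingCat.comp_apply,
    ← X.presheaf.map_comp]
  rfl

lemma basicOpen_restrictSections {U V : X.Opens} (h : U ≤ V) (f : Γ(X, V)) :
    X.basicOpen (restrictSections h f) = U ⊓ X.basicOpen f :=
  X.basicOpen_res f (homOfLE h).op

lemma exists_pow_mul_eq_of_restrictSections_eq {V : X.Opens} (hV : IsCompact V.1)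
    (hV' : IsQuasiSeparated V.1) (f : Γ(X, V)) {x y : Γ(X, V)} {B : X.Opens}
    (hB : B = X.basicOpen f) (hBV : B ≤ V)
    (h : restrictSections hBV x = restrictSections hBV y) : ∃ n : ℕ, f ^ n * x = f ^ n * y := by
  subst hB
  have := isLocalization_basicOpen_of_qcqs hV hV' f
  obtain ⟨⟨_, n, rfl⟩, hn⟩ := IsLocalization.exists_of_eq (M := Submonoid.powers f) h
  exact ⟨n, hn⟩

lemma exists_restrictSections_eq_pow_mul {V : X.Opens} (hV : IsCompact V.1)
    (hV' : IsQuasiSeparated V.1) (f : Γ(X, V)) (h : X.basicOpen f ≤ V) (x : Γ(X, X.basicOpen f)) :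
    ∃ (n : ℕ) (y : Γ(X, V)), restrictSections h y = restrictSections h f ^ n * x := by
  have := isLocalization_basicOpen_of_qcqs hV hV' f
  obtain ⟨⟨y, _, n, rfl⟩, hn⟩ := IsLocalization.surj (Submonoid.powers f) x
  refine ⟨n, y, ?_⟩
  have hn' : x * restrictSections h (f ^ n) = restrictSections h y := hn
  rw [← hn', map_pow, mul_comm]

lemma eq_of_forall_restrictSections_eq {D : X.Opens} {ι : Type*} (B : ι → X.Opens)
    (hB : ∀ i, B i ≤ D) (hD : D ≤ ⨆ i, B i) {x y : Γ(X, D)}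
    (h : ∀ i, restrictSections (hB i) x = restrictSections (hB i) y) : x = y :=
  X.sheaf.eq_of_locally_eq' B D (fun i => homOfLE (hB i)) hD x y h

theorem restrictSections_bijective_of_homsExtend {R : Type u} [CommRing R] {I : Ideal R}
    (h₀ : NoSectionsSupported I R) (h₁ : HomsExtend I R) {W D : X.Opens} (hW : IsAffineOpen W)
    (ρ : R →+* Γ(X, W)) (hρ : Function.Bijective ρ) (hDW : D ≤ W) (hDc : IsCompact D.1)
    (hD : D = ⨆ f : I, X.basicOpen (ρ f)) : Function.Bijective (restrictSections hDW) := by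
  have hWc := hW.isCompact
  have hWs : IsQuasiSeparated W.1 := hW.isQuasiSeparated
  have hDs : IsQuasiSeparated D.1 := hWs.of_subset hDW
  have hBD (f : I) : X.basicOpen (ρ f) ≤ D := hD ▸ le_iSup (fun f : I => X.basicOpen (ρ f)) f
  let σ : R →+* Γ(X, D) := (restrictSections hDW).comp ρ
  have hσ : Function.Injective σ := by
    refine (injective_iff_map_eq_zero _).2 fun x hx => ?_
    refine h₀ (LinearMap.ker (LinearMap.toSpanSingleton R R x)) (fun f hf => ?_) x fun j hj => hj
    obtain ⟨n, hn⟩ := exists_pow_mul_eq_of_restrictSections_eq (x := ρ x) (y := 0) hWc hWs (ρ f) rfl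
      (X.basicOpen_le _) (by
        rw [map_zero, ← restrictSections_restrictSections (hBD ⟨f, hf⟩) hDW]
        erw [hx]
        rw [map_zero])
    refine ⟨n, ?_⟩
    rw [mul_zero, ← map_pow, ← map_mul] at hn
    exact (map_eq_zero_iff ρ hρ.1).1 hn
  constructor
  · intro x y hxy
    obtain ⟨x, rfl⟩ := hρ.2 x
    obtain ⟨y, rfl⟩ := hρ.2 y
    exact congrArg ρ (hσ hxy)
  intro s
  -- The ideal of denominators of s. Multiplication by s is a linear map J → R, and the element
  -- representing it extends s.
  let J : Ideal R :=
    { carrier := {x | ∃ y, σ y = σ x * s}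
      add_mem' := by
        rintro a b ⟨c, hc⟩ ⟨d, hd⟩
        exact ⟨c + d, by rw [map_add, map_add, hc, hd, add_mul]⟩
      zero_mem' := ⟨0, by simp⟩
      smul_mem' := by
        rintro a b ⟨c, hc⟩
        exact ⟨a * c, by rw [map_mul, hc, smul_eq_mul, map_mul, mul_assoc]⟩ }
  -- On the basic open set of f, some f ^ n * s extends to W; a further power f ^ l makes the
  -- equality hold on all of D.
  have hIJ : I ≤ J.radical := by
    intro f hf
    obtain ⟨n, y, hy⟩ := exists_restrictSections_eq_pow_mul hWc hWs (ρ f) (X.basicOpen_le _)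
      (restrictSections (hBD ⟨f, hf⟩) s)
    obtain ⟨y, rfl⟩ := hρ.2 y
    have hB : X.basicOpen (ρ f) = X.basicOpen (σ f) := by
      change _ = X.basicOpen (restrictSections hDW (ρ f))
      rw [basicOpen_restrictSections, inf_eq_right.2 (hBD ⟨f, hf⟩)]
    obtain ⟨l, hl⟩ := exists_pow_mul_eq_of_restrictSections_eq (x := σ y) (y := σ f ^ n * s)
      hDc hDs (σ f) hB (hBD ⟨f, hf⟩) (by
        change restrictSections _ (restrictSections hDW (ρ y)) =
          restrictSections _ (restrictSections hDW (ρ f) ^ n * s)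
        simpa using hy)
    refine ⟨l + n, f ^ l * y, ?_⟩
    rw [map_mul, map_pow, hl, map_pow, pow_add, mul_assoc]
  choose y hy using fun x : J => x.2
  let φ : J →ₗ[R] R :=
    { toFun := y
      map_add' := fun a b => hσ (by
        rw [hy, map_add, hy, hy]
        change σ (a.1 + b.1) * s = _
        rw [map_add, add_mul])
      map_smul' := fun a b => hσ (by
        rw [hy, RingHom.id_apply, smul_eq_mul, map_mul, hy]
        change σ (a * b.1) * s = _
        rw [map_mul, mul_assoc]) }
  obtain ⟨t, ht⟩ := h₁ J hIJ φ
  refine ⟨ρ t, ?_⟩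
  refine eq_of_forall_restrictSections_eq _ hBD hD.le fun f => ?_
  obtain ⟨n, hn⟩ := hIJ f.2
  have h1 : σ (f.1 ^ n) * σ t = σ (f.1 ^ n) * s := by
    rw [← hy ⟨_, hn⟩, ← map_mul]
    exact congrArg σ (ht ⟨_, hn⟩).symm
  have hu : IsUnit (restrictSections (hBD f) (σ (f.1 ^ n))) := by
    change IsUnit (restrictSections _ (restrictSections hDW (ρ (f.1 ^ n))))
    rw [restrictSections_restrictSections, map_pow, map_pow]
    exact (RingedSpace.isUnit_res_basicOpen X.toRingedSpace (ρ f)).pow n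
  refine hu.mul_left_cancel ?_
  rw [← map_mul, ← map_mul]
  exact congrArg _ h1

end Sections

/-! ### The unit of restriction and pushforward, tested on a basis. -/

section Modules

open TopologicalSpace Scheme.Modules Opposite

variable {X : Scheme.{u}}

/-- Sections of `M` over `W` restrict bijectively to `W ⊓ V`. -/
def RestrictsBijectively (M : X.Modules) (V W : X.Opens) : Prop :=
  Function.Bijective (M.presheaf.map (homOfLE (inf_le_left : W ⊓ V ≤ W)).op)

lemma isIso_restrictAdjunction_unit (M : X.Modules) (V : X.Opens) {ι : Type*} (B : ι → X.Opens)
    (hB : Opens.IsBasis (Set.range B)) (h : ∀ i, RestrictsBijectively M V (B i)) :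
    IsIso ((restrictAdjunction V.ι).unit.app M) := by
  let η := (restrictAdjunction V.ι).unit.app M
  let F : TopCat.Sheaf Ab X := ⟨M.presheaf, M.isSheaf⟩
  let G : TopCat.Sheaf Ab X := ⟨_, ((pushforward V.ι).obj (M.restrict V.ι)).isSheaf⟩
  let φ : F ⟶ G := ⟨η.mapPresheaf⟩
  have hφ : IsIso φ := by
    refine TopCat.Sheaf.isIso_iff_isIso_basis hB fun i => ?_
    rw [ConcreteCategory.isIso_iff_bijective]
    have hle : V.ι ''ᵁ V.ι ⁻¹ᵁ B i = B i ⊓ V := by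
      rw [Scheme.Hom.image_preimage_eq_opensRange_inf, Scheme.Opens.opensRange_ι, inf_comm]
    have : φ.hom.app (op (B i)) = M.presheaf.map (homOfLE (inf_le_left : B i ⊓ V ≤ B i)).op ≫
        M.presheaf.map (eqToHom hle).op := by
      rw [← Functor.map_comp]
      rfl
    rw [this]
    exact (ConcreteCategory.bijective_of_isIso (M.presheaf.map (eqToHom hle).op)).comp (h i)
  have : IsIso ((toPresheaf X).map η) := (inferInstance : IsIso ((TopCat.Sheaf.forget Ab X).map φ))
  exact isIso_of_reflects_iso η (toPresheaf X)

lemma RestrictsBijectively.of_iso {M N : X.Modules} {V W O : X.Opens} (hWO : W ≤ O)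
    (e : M.restrict O.ι ≅ N.restrict O.ι) (h : RestrictsBijectively N V W) :
    RestrictsBijectively M V W := by
  obtain ⟨W', rfl⟩ : ∃ W' : (O : Scheme).Opens, W = O.ι ''ᵁ W' := ⟨O.ι ⁻¹ᵁ W, by
    rw [Scheme.Hom.image_preimage_eq_opensRange_inf, Scheme.Opens.opensRange_ι,
      inf_eq_right.2 hWO]⟩
  let W'' : (O : Scheme).Opens := W' ⊓ O.ι ⁻¹ᵁ V
  have hW'' : O.ι ''ᵁ W'' = O.ι ''ᵁ W' ⊓ V := by
    have : O.ι ''ᵁ W'' = O.ι ''ᵁ W' ⊓ O.ι ''ᵁ O.ι ⁻¹ᵁ V :=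
      Opens.ext (Set.image_inter O.ι.isOpenEmbedding.injective)
    rw [this, Scheme.Hom.image_preimage_eq_opensRange_inf,
      Scheme.Opens.opensRange_ι, ← inf_assoc, inf_eq_left.2 hWO]
  have key (K : X.Modules) : RestrictsBijectively K V (O.ι ''ᵁ W') ↔
      Function.Bijective ((K.restrict O.ι).presheaf.map (homOfLE (inf_le_left : W'' ≤ W')).op) := by
    have : (K.restrict O.ι).presheaf.map (homOfLE (inf_le_left : W'' ≤ W')).op =
        K.presheaf.map (homOfLE (inf_le_left : O.ι ''ᵁ W' ⊓ V ≤ O.ι ''ᵁ W')).op ≫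
          K.presheaf.map (eqToHom hW'').op := by
      rw [← Functor.map_comp]
      rfl
    rw [this]
    exact (Function.Bijective.of_comp_iff'
      (ConcreteCategory.bijective_of_isIso (K.presheaf.map (eqToHom hW'').op)) _).symm
  rw [key] at h ⊢
  have hn := e.hom.mapPresheaf.naturality (homOfLE (inf_le_left : W'' ≤ W')).op
  have h1 : Function.Bijective (e.hom.app W') := ConcreteCategory.bijective_of_isIso _
  have h2 : Function.Bijective (e.hom.app W'') := ConcreteCategory.bijective_of_isIso _
  refine (Function.Bijective.of_comp_iff' h2 _).1 ?_
  have := h.comp h1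
  convert this using 1
  exact congrArg (fun f => (ConcreteCategory.hom f : _ → _)) hn

end Modules

/-! ### Charts of the product flat over affine space over the base. -/

section FlatCharts

open TensorProduct

/-- An affine chart of `X` over an affine Noetherian scheme mapping to `U`, flat over affine
`m`-space. -/
structure FlatChart {X U : Scheme.{u}} (f : X ⟶ U) (m : ℕ) where
  A : CommRingCat.{u}
  R : CommRingCat.{u}
  toBase : Spec A ⟶ U
  ι : Spec R ⟶ X
  [isOpenImmersion : IsOpenImmersion ι]
  φ : A ⟶ R
  comp_eq : ι ≫ f = Spec.map φ ≫ toBase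
  coord : MvPolynomial (Fin m) A →+* R
  coord_comp : coord.comp MvPolynomial.C = φ.hom
  flat : coord.Flat
  finiteType : φ.hom.FiniteType
  [isNoetherianRing : IsNoetherianRing A]

attribute [instance] FlatChart.isOpenImmersion FlatChart.isNoetherianRing

/-- Localizing R with A and m fixed preserves flatness, so charts can be shrunk into any open set.
-/
lemma FlatChart.exists_range_subset {X U : Scheme.{u}} {f : X ⟶ U} {m : ℕ} (c : FlatChart f m)
    (z : Spec c.R) {O : X.Opens} (hz : c.ι z ∈ O) :
    ∃ c' : FlatChart f m, c.ι z ∈ Set.range c'.ι ∧ Set.range c'.ι ⊆ O := by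
  obtain ⟨_, ⟨t, rfl⟩, hzt, htO⟩ := PrimeSpectrum.isTopologicalBasis_basic_opens.exists_subset_of_mem_open
    (show z ∈ (c.ι ⁻¹ᵁ O).1 from hz) (c.ι ⁻¹ᵁ O).2
  let loc : c.R ⟶ CommRingCat.of (Localization.Away t) :=
    CommRingCat.ofHom (algebraMap c.R (Localization.Away t))
  have : IsOpenImmersion (Spec.map loc) := IsOpenImmersion.of_isLocalization t
  have hrange : Set.range (Spec.map loc) = {q : PrimeSpectrum c.R | t ∉ q.asIdeal} :=
    PrimeSpectrum.localization_away_comap_range _ t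
  refine ⟨{ A := c.A, R := .of (Localization.Away t), toBase := c.toBase, ι := Spec.map loc ≫ c.ι,
            φ := c.φ ≫ loc, comp_eq := ?_, coord := loc.hom.comp c.coord, coord_comp := ?_,
            flat := ?_, finiteType := ?_ }, ?_, ?_⟩
  · rw [Category.assoc, c.comp_eq, Spec.map_comp, Category.assoc]
  · rw [RingHom.comp_assoc, c.coord_comp]
    rfl
  · exact RingHom.Flat.comp c.flat
      (RingHom.flat_algebraMap_iff.2 (IsLocalization.flat _ (Submonoid.powers t)))
  · exact RingHom.FiniteType.comp (RingHom.finiteType_algebraMap.2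
      (IsLocalization.finiteType_of_monoid_fg (Submonoid.powers t) _)) c.finiteType
  · obtain ⟨w, hw⟩ : z ∈ Set.range (Spec.map loc) := hrange.ge hzt
    exact ⟨w, (Scheme.Hom.comp_apply (Spec.map loc) c.ι w).trans (congrArg c.ι hw)⟩
  · rintro _ ⟨w, rfl⟩
    change (Spec.map loc ≫ c.ι) w ∈ O
    rw [Scheme.Hom.comp_apply]
    exact htO (hrange.le ⟨w, rfl⟩)

lemma exists_flatChart {k : Type u} [Field k] {Y U : Scheme.{u}}
    (pY : Y ⟶ Spec (CommRingCat.of k)) (pU : U ⟶ Spec (CommRingCat.of k)) [Smooth pY]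
    [LocallyOfFiniteType pU] {n : ℕ} (hdim : IsPureDim Y n) (x : ↥(pullback pU pY)) :
    ∃ m, n ≤ m ∧ ∃ c : FlatChart (pullback.fst pU pY) m, x ∈ Set.range c.ι := by
  obtain ⟨A, j, φ, hj, hxj, -, hφ⟩ := exists_affine_over pU (O := ⊤) (x := pullback.fst pU pY x)
    trivial
  obtain ⟨m, c, hc⟩ := exists_etaleChart pY (pullback.snd pU pY x)
  refine ⟨m, le_of_etaleChart pY hdim c hc.choose, ?_⟩
  have hft : φ.hom.FiniteType := by
    have : LocallyOfFiniteType (Spec.map φ) := hφ ▸ inferInstance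
    exact (HasRingHomProperty.Spec_iff (P := @LocallyOfFiniteType)).1 this
  have hD : c.φ.hom.FiniteType := by
    have : LocallyOfFiniteType (Spec.map c.φ) := c.comp_eq ▸ inferInstance
    exact (HasRingHomProperty.Spec_iff (P := @LocallyOfFiniteType)).1 this
  let : Algebra k A := φ.hom.toAlgebra
  let : Algebra k c.D := c.φ.hom.toAlgebra
  have : Algebra.FiniteType k A := hft
  have : Algebra.FiniteType k c.D := hD
  have : IsNoetherianRing A := Algebra.FiniteType.isNoetherianRing k A
  let g : MvPolynomial (Fin m) k →ₐ[k] c.D :=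
    { toRingHom := c.coord
      commutes' := fun r => congrArg (fun f : k →+* c.D => f r) c.coord_comp }
  have hg : g.Flat := by
    have := c.etale
    algebraize [c.coord]
    exact RingHom.flat_algebraMap_iff.2 inferInstance
  let G := (Algebra.TensorProduct.lTensor (S := A) A g).comp
      (MvPolynomial.algebraTensorAlgEquiv k A).symm.toAlgHom
  have hG : G.Flat := flat_mvPolynomial_tensor g hg
  have hφ' : Spec.map (CommRingCat.ofHom (algebraMap k A)) ≫ 𝟙 _ = j ≫ pU :=
    (Category.comp_id _).trans hφ.symm
  have hc' : Spec.map (CommRingCat.ofHom (algebraMap k c.D)) ≫ 𝟙 _ = c.ι ≫ pY :=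
    (Category.comp_id _).trans c.comp_eq.symm
  let ι : Spec (.of (A ⊗[k] c.D)) ⟶ pullback pU pY :=
    (pullbackSpecIso k A c.D).inv ≫ pullback.map _ _ pU pY j c.ι (𝟙 _)
      hφ' hc'
  have hι : IsOpenImmersion ι := inferInstance
  refine ⟨{ A := A, R := .of (A ⊗[k] c.D), toBase := j, ι := ι,
            φ := CommRingCat.ofHom (algebraMap A (A ⊗[k] c.D)), comp_eq := ?_,
            coord := G.toRingHom, coord_comp := G.comp_algebraMap, flat := hG,
            finiteType := RingHom.finiteType_algebraMap.2 inferInstance }, ?_⟩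
  · rw [Category.assoc, pullback.map, pullback.lift_fst, pullbackSpecIso_inv_fst'_assoc]
  · have : Set.range ι = Set.range (pullback.map _ _ pU pY j c.ι (𝟙 _)
        hφ' hc') := by
      have h : ⇑ι = pullback.map _ _ pU pY j c.ι (𝟙 _) hφ' hc' ∘ (pullbackSpecIso k A c.D).inv :=
        funext (Scheme.Hom.comp_apply _ _)
      rw [h]
      exact (Scheme.homeoOfIso (pullbackSpecIso k A c.D)).symm.surjective.range_comp _
    rw [this, Scheme.Pullback.range_map]
    exact ⟨hxj, hc⟩

end FlatCharts

/-! ### Dimension of the fibres of Z inside a chart. -/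

section Dimension

lemma isIrreducible_preimage_val {T : Type*} [TopologicalSpace T] {C W : Set T}
    (hC : IsIrreducible C) (hCW : C ⊆ W) : IsIrreducible (Subtype.val ⁻¹' C : Set W) := by
  refine ⟨let ⟨x, hx⟩ := hC.1; ⟨⟨x, hCW hx⟩, hx⟩, ?_⟩
  rintro _ _ ⟨u, hu, rfl⟩ ⟨v, hv, rfl⟩ ⟨x, hxC, hxu⟩ ⟨y, hyC, hyv⟩
  obtain ⟨z, hzC, hz⟩ := hC.2 u v hu hv ⟨x, hxC, hxu⟩ ⟨y, hyC, hyv⟩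
  exact ⟨⟨z, hCW hzC⟩, hzC, hz⟩

lemma IsPureDim.topologicalKrullDim_le {T : Type*} [TopologicalSpace T] {d : ℕ}
    (h : IsPureDim T d) : topologicalKrullDim T ≤ d := by
  refine iSup_le fun s => ?_
  obtain ⟨W, hW, hsW⟩ := exists_mem_irreducibleComponents_subset_of_isIrreducible
    (s.last : Set T) s.last.isIrreducible'
  rw [← h W hW]
  have hcl : IsClosed W := isClosed_of_mem_irreducibleComponents W hW
  have hmem (j) : (s j : Set T) ⊆ W :=
    Set.Subset.trans (SetLike.coe_subset_coe.2 (s.strictMono.monotone (Fin.le_last j))) hsW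
  let t (j : Fin (s.length + 1)) : TopologicalSpace.IrreducibleCloseds W :=
    { carrier := Subtype.val ⁻¹' (s j : Set T)
      isIrreducible' := isIrreducible_preimage_val (s j).isIrreducible' (hmem j)
      isClosed' := (s j).isClosed'.preimage continuous_subtype_val }
  have ht : StrictMono t := fun a b hab => by
    have := s.strictMono hab
    refine lt_of_le_not_ge (fun x hx => this.le hx) fun hle => this.not_ge fun x hx => ?_
    exact hle (show (⟨x, hmem b hx⟩ : W) ∈ t b from hx)
  exact le_iSup (α := WithBot ℕ∞)
    (fun p : LTSeries (TopologicalSpace.IrreducibleCloseds W) => (p.length : WithBot ℕ∞))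
    ⟨s.length, t, fun i => ht i.castSucc_lt_succ⟩

/-- The part of Z in the chart over p carries the topology induced from the fibre of Z over the
image of p. -/
lemma FlatChart.topologicalKrullDim_fiber_le {X U Z : Scheme.{u}} {f : X ⟶ U} {m : ℕ}
    (c : FlatChart f m) (i : Z ⟶ X) [IsClosedImmersion i] {d : ℕ} (hZ : IsEquidimensional (i ≫ f) d)
    (p : Spec c.A) :
    topologicalKrullDim {q : Spec c.R | c.ι q ∈ Set.range i ∧ Spec.map c.φ q = p} ≤ d := by
  set S := {q : Spec c.R | c.ι q ∈ Set.range i ∧ Spec.map c.φ q = p}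
  have hmem (q : S) : c.ι q.1 ∈ Set.range i := q.2.1
  let z (q : S) : Z := (hmem q).choose
  have hz (q : S) : i (z q) = c.ι q.1 := (hmem q).choose_spec
  have hfib (q : S) : z q ∈ (i ≫ f) ⁻¹' {c.toBase p} := by
    rw [Set.mem_preimage, Set.mem_singleton_iff, Scheme.Hom.comp_apply, hz,
      ← Scheme.Hom.comp_apply, c.comp_eq, Scheme.Hom.comp_apply, q.2.2]
  have hind : Topology.IsInducing z := by
    refine (i.isClosedEmbedding.isInducing.of_comp_iff).1 ?_
    rw [show ⇑i ∘ z = c.ι ∘ Subtype.val from funext hz]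
    exact c.ι.isOpenEmbedding.isInducing.comp .subtypeVal
  exact (((i ≫ f).fiberHomeo (c.toBase p)).symm.isInducing.comp
    (hind.codRestrict hfib)).topologicalKrullDim_le.trans (hZ _).topologicalKrullDim_le

end Dimension

/-! ### Functions on a chart extend across Z. -/

section Restriction

lemma FlatChart.restrictSections_bijective {X U Z : Scheme.{u}} {f : X ⟶ U} {m : ℕ}
    (c : FlatChart f m) (i : Z ⟶ X) [IsClosedImmersion i] {d : ℕ} (hZ : IsEquidimensional (i ≫ f) d)
    (hd : d + 2 ≤ m) :
    Function.Bijective (restrictSections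
      (inf_le_left : c.ι.opensRange ⊓ complement i ≤ c.ι.opensRange)) := by
  let : Algebra c.A c.R := c.φ.hom.toAlgebra
  have : Algebra.FiniteType c.A c.R := c.finiteType
  have : IsNoetherianRing c.R := Algebra.FiniteType.isNoetherianRing c.A c.R
  let g : MvPolynomial (Fin m) c.A →ₐ[c.A] c.R :=
    { toRingHom := c.coord
      commutes' := fun r => congrArg (fun f : c.A →+* c.R => f r) c.coord_comp }
  let T : Set (PrimeSpectrum c.R) := c.ι ⁻¹' Set.range i
  have hT : IsClosed T := i.isClosedEmbedding.isClosed_range.preimage c.ι.continuous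
  let I := PrimeSpectrum.vanishingIdeal T
  have hI (q : PrimeSpectrum c.R) : I ≤ q.asIdeal ↔ q ∈ T := by
    rw [← hT.closure_eq, ← PrimeSpectrum.zeroLocus_vanishingIdeal_eq_closure]
    rfl
  obtain ⟨h₀, h₁⟩ := homsExtend_of_fibre_dimension_le (I := I) g c.flat hd fun p => by
    have : {q : PrimeSpectrum c.R | I ≤ q.asIdeal ∧ PrimeSpectrum.comap (algebraMap c.A c.R) q = p} =
        {q : Spec c.R | c.ι q ∈ Set.range i ∧ Spec.map c.φ q = p} :=
      Set.ext fun q => and_congr_left' (hI q)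
    rw [this]
    exact c.topologicalKrullDim_fiber_le i hZ p
  let e : c.R ≅ Γ(X, c.ι ''ᵁ ⊤) := (Scheme.ΓSpecIso c.R).symm ≪≫ (c.ι.appIso ⊤).symm
  have hbasic (f : c.R) : X.basicOpen (e.hom f) = c.ι ''ᵁ PrimeSpectrum.basicOpen f := by
    rw [← basicOpen_eq_of_affine, Scheme.image_basicOpen]
    rfl
  rw [← Scheme.Hom.image_top_eq_opensRange]
  have hW : IsAffineOpen (c.ι ''ᵁ ⊤) := by
    rw [Scheme.Hom.image_top_eq_opensRange]
    exact isAffineOpen_opensRange c.ι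
  have hD : c.ι ''ᵁ ⊤ ⊓ complement i = c.ι ''ᵁ c.ι ⁻¹ᵁ complement i := by
    rw [Scheme.Hom.image_preimage_eq_opensRange_inf, Scheme.Hom.image_top_eq_opensRange]
  refine restrictSections_bijective_of_homsExtend h₀ h₁ hW e.hom.hom
    (ConcreteCategory.bijective_of_isIso e.hom) _ ?_ ?_
  · rw [hD]
    exact (TopologicalSpace.NoetherianSpace.isCompact (α := PrimeSpectrum c.R) _).image
      c.ι.continuous
  · refine TopologicalSpace.Opens.ext (Set.ext fun x => ?_)
    rw [hD]
    simp only [TopologicalSpace.Opens.coe_iSup, Set.mem_iUnion]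
    constructor
    · rintro ⟨q, hq, rfl⟩
      obtain ⟨f, hf, hfq⟩ := Set.not_subset.1 (mt (hI q).1 hq)
      refine ⟨⟨f, hf⟩, ?_⟩
      rw [SetLike.mem_coe]
      exact (hbasic f).ge ⟨q, hfq, rfl⟩
    · rintro ⟨f, hx⟩
      obtain ⟨q, hq, rfl⟩ := (hbasic f.1).le hx
      exact ⟨q, fun hqT => hq ((hI q).2 hqT f.2), rfl⟩

end Restriction

/-! ### From the structure sheaf to invertible sheaves. -/

section Invertible

open Scheme.Modules TopologicalSpace

lemma exists_restrict_iso_structureModule {X : Scheme.{u}} {L : X.Modules}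
    (hL : IsInvertibleSheaf L) (x : X) : ∃ O : X.Opens, x ∈ O ∧
      Nonempty (L.restrict O.ι ≅ (structureModule X).restrict O.ι) := by
  obtain ⟨O, hxO, ⟨e⟩⟩ := hL x
  exact ⟨O, hxO, ⟨(restrictFunctorIsoPullback O.ι).app L ≪≫ e ≪≫ (restrictUnitIso O.ι).symm⟩⟩

lemma isIso_unit_of_isInvertibleSheaf {X : Scheme.{u}} {L : X.Modules} (hL : IsInvertibleSheaf L)
    (V : X.Opens) (h : ∀ (x : X) (O : X.Opens), x ∈ O → ∃ W ≤ O, x ∈ W ∧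
      RestrictsBijectively (structureModule X) V W) :
    IsIso ((restrictAdjunction V.ι).unit.app L) := by
  refine isIso_restrictAdjunction_unit L V
    (fun W : {W : X.Opens // RestrictsBijectively L V W} => W.1) ?_ fun W => W.2
  rw [Opens.isBasis_iff_nbhd]
  intro O x hx
  obtain ⟨O', hxO', ⟨e⟩⟩ := exists_restrict_iso_structureModule hL x
  obtain ⟨W, hWO, hxW, hW⟩ := h x (O ⊓ O') ⟨hx, hxO'⟩
  exact ⟨W, ⟨⟨W, .of_iso (hWO.trans inf_le_right) e hW⟩, rfl⟩, hxW, hWO.trans inf_le_left⟩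

lemma picMap_ι_injective {X : Scheme.{u}} (V : X.Opens)
    (h : ∀ (x : X) (O : X.Opens), x ∈ O → ∃ W ≤ O, x ∈ W ∧
      RestrictsBijectively (structureModule X) V W) :
    Function.Injective (Pic.map V.ι) := by
  intro a b
  refine Quotient.inductionOn₂ a b fun L₁ L₂ hL => ?_
  obtain ⟨e⟩ := Quotient.exact hL
  have h₁ := isIso_unit_of_isInvertibleSheaf L₁.property V h
  have h₂ := isIso_unit_of_isInvertibleSheaf L₂.property V h
  let e' : (restrictFunctor V.ι).obj L₁.obj ≅ (restrictFunctor V.ι).obj L₂.obj :=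
    (restrictFunctorIsoPullback V.ι).app L₁.obj ≪≫ (ObjectProperty.ι _).mapIso e ≪≫
      ((restrictFunctorIsoPullback V.ι).app L₂.obj).symm
  exact Quotient.sound ⟨ObjectProperty.isoMk _
    (asIso ((restrictAdjunction V.ι).unit.app L₁.obj) ≪≫ (pushforward V.ι).mapIso e' ≪≫
      (asIso ((restrictAdjunction V.ι).unit.app L₂.obj)).symm)⟩

end Invertible

end PicardRestriction


open PicardRestriction in
theorem proposition2p4 {k : Type u} [Field k]
    {Y U Z : Scheme.{u}} (pY : Y ⟶ Spec (CommRingCat.of k)) (pU : U ⟶ Spec (CommRingCat.of k))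
    (hsm : Smooth pY) (hproj : IsProjectiveOver pY)
    (n : ℕ) (hdim : IsPureDim Y n)
    (hU : LocallyOfFiniteType pU) (hUqc : QuasiCompact pU)
    (i : Z ⟶ pullback pU pY) (hi : IsClosedImmersion i)
    (d : ℕ) (hZ : IsEquidimensional (i ≫ pullback.fst pU pY) d) (hd : d + 2 ≤ n) :
    Function.Injective (Pic.map (complement i).ι) := by
  refine picMap_ι_injective _ fun x O hx => ?_
  obtain ⟨m, hm, c, z, rfl⟩ := exists_flatChart pY pU hdim x
  obtain ⟨c', hz, hO⟩ := c.exists_range_subset z hx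
  exact ⟨c'.ι.opensRange, hO, hz, c'.restrictSections_bijective i hZ (hd.trans hm)⟩
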